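/- For an integer $n\ge 1$ let $\mathrm{U}(n)$ be the group of unitary complex $n\times n$ matrices, let $\mu_n$ be its normalized Haar measure, and let $$d_{1,n}(u,v)=\frac1n\,\mathrm{tr}\,|u-v|,\qquad |a|=(a^*a)^{1/2},$$ be the normalized trace metric, where $\mathrm{tr}$ is the unnormalized trace. Let also $d_n(u,v)=\big(\mathrm{tr}\,((u-v)^*(u-v))\big)^{1/2}$ be the unnormalized Hilbert--Schmidt metric. An mm-space $(X,d,\mu)$ is a metric space $(X,d)$ with a Borel probability measure $\mu$. Its concentration function is given by $\alpha_X(0)=1/2$ and, for $\varepsilon>0$, $$\alpha_X(\varepsilon)=1-\inf\{\mu(A_\varepsilon) : A\subseteq X \text{ Borel},\ \mu(A)\ge 1/2\},\qquad A_\varepsilon=\{x\in X : d(x,a)<\varepsilon \text{ for some } a\in A\}.$$ A sequence $(X_n,d_n,\mu_n)_{n\ge1}$ of mm-spaces is a Lévy family if $\alpha_{X_n}(\varepsilon)\to0$ as $n\to\infty$ for every $\varepsilon>0$. Then the following hold. 1. $(\mathrm{U}(n),d_{1,n},\mu_n)_{n\ge1}$ is a Lévy family (of mm-spaces). 2. For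 all $n\ge1$ and all $\varepsilon\ge0$, the concentration function of $(\mathrm{U}(n),d_{1,n},\mu_n)$ satisfies $$\alpha_{\mathrm{U}(n)}(\varepsilon)\le 2\exp\left(-\frac{n\varepsilon^2}{128}\right).$$ 3. $(\mathrm{U}(n),d_n/n,\mu_n)_{n\ge1}$ is a Lévy family (of mm-spaces). -/

import Mathlib

open MeasureTheory Filter Topology
open scoped MatrixOrder

noncomputable section

/-- `(X, d, μ)` is an mm-space: `d` is a metric on `X`, the σ-algebra on `X` is the Borel σ-algebra
of `(X, d)`, and `μ` is a probability measure on it. -/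
def IsMMSpace {X : Type*} [MeasurableSpace X] (d : X → X → ℝ) (μ : Measure X) : Prop :=
  (∃ m : MetricSpace X, (∀ x y, m.dist x y = d x y) ∧
    @BorelSpace X m.toUniformSpace.toTopologicalSpace _) ∧
  IsProbabilityMeasure μ

/-- The (open) `ε`-neighbourhood of `A` with respect to `d`. -/
def nbhd {X : Type*} (d : X → X → ℝ) (ε : ℝ) (A : Set X) : Set X :=
  {x | ∃ a ∈ A, d x a < ε}

open Classical in
/-- The concentration function of `(X, d, μ)`, at `ε ≥ 0`. -/
def concentrationFunction {X : Type*} [MeasurableSpace X] (d : X → X → ℝ) (μ : Measure X)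
    (ε : ℝ) : ℝ :=
  if ε = 0 then 1 / 2
  else 1 - sInf {r : ℝ | ∃ A : Set X, MeasurableSet A ∧ 1 / 2 ≤ μ.real A ∧
    r = μ.real (nbhd d ε A)}

/-- A sequence of mm-spaces, indexed by the positive integers, is a Lévy family if its
concentration functions tend to `0` pointwise on `(0, ∞)`. -/
def IsLevyFamily {X : ℕ+ → Type*} [∀ n, MeasurableSpace (X n)]
    (d : ∀ n, X n → X n → ℝ) (μ : ∀ n, Measure (X n)) : Prop :=
  (∀ n, IsMMSpace (d n) (μ n)) ∧
  ∀ ε : ℝ, 0 < ε → Tendsto (fun n => concentrationFunction (d n) (μ n) ε) atTop (𝓝 0)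

/-- The unitary group `U(n)`, with the topology inherited from the complex `n × n` matrices. -/
abbrev UGroup (n : ℕ) : Type := Matrix.unitaryGroup (Fin n) ℂ

/-- The normalized trace metric `(1/n) tr |u - v|`, where `|a| = (a* a)^(1/2)`
(the trace is a nonnegative real number). -/
def traceDist (n : ℕ) (u v : UGroup n) : ℝ :=
  (1 / (n : ℝ)) * (Matrix.trace (CFC.abs ((u : Matrix (Fin n) (Fin n) ℂ) - (v : Matrix (Fin n) (Fin n) ℂ)))).re

/-- The unnormalized Hilbert-Schmidt metric `(tr ((u - v)* (u - v)))^(1/2)`. -/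
def hilbertSchmidtDist (n : ℕ) (u v : UGroup n) : ℝ :=
  Real.sqrt (Matrix.trace (star ((u : Matrix (Fin n) (Fin n) ℂ) - (v : Matrix (Fin n) (Fin n) ℂ)) *
    ((u : Matrix (Fin n) (Fin n) ℂ) - (v : Matrix (Fin n) (Fin n) ℂ)))).re

instance (n : ℕ) : CompactSpace (UGroup n) := by
  rw [← isCompact_univ_iff, Subtype.isCompact_iff, Set.image_univ, Subtype.range_coe_subtype]
  have hK : IsCompact (Set.univ.pi fun _ : Fin n => Set.univ.pi fun _ : Fin n =>
      Metric.closedBall (0 : ℂ) 1) :=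
    isCompact_univ_pi fun _ => isCompact_univ_pi fun _ => isCompact_closedBall _ _
  refine hK.of_isClosed_subset ?_ ?_
  · have : {x : Matrix (Fin n) (Fin n) ℂ | x ∈ Matrix.unitaryGroup (Fin n) ℂ} =
        {x | x * star x = 1} := by
      ext x; exact Matrix.mem_unitaryGroup_iff
    rw [this]
    exact isClosed_eq (by fun_prop) continuous_const
  · intro x hx i _ j _
    simpa using entry_norm_bound_of_unitary hx i j

instance (n : ℕ) : MeasurableSpace (UGroup n) := borel _

instance (n : ℕ) : BorelSpace (UGroup n) := ⟨rfl⟩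

/-- The normalized Haar measure on `U(n)`: the Haar measure giving the whole group mass `1`. -/
def haarU (n : ℕ) : Measure (UGroup n) := Measure.haarMeasure ⊤

end

/-! The argument is the martingale method along the chain of closed subgroups `flagStabilizer n k`,
which descends from `U(n)` to the trivial group in `n` steps. Averaging a Lipschitz `f` over the
cosets `x H_k` gives a martingale from a constant to `f`. Each increment is small: if `h` fixes the
first `k` basis vectors, a complex reflection `w` agrees with `h` on one more, and `w - 1` has rank
at most one and trace norm at most `2`, so `w` lies within `2 / n` of `1`
(`exists_traceDist_one_le`). Bi-invariance of the metric turns this into an oscillation bound on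
each coset.

Hoeffding's lemma, applied on each coset, yields a subgaussian Laplace transform
(`integral_exp_average_le`, `exists_integral_exp_le`). Using it for positive and negative multiples
of the distance to `A` and multiplying removes the unknown mean, and a Chernoff bound gives `2 exp
(-n ε² / 16)`, stronger than required. The normalized Hilbert–Schmidt metric is dominated by the
trace metric, so its neighbourhoods are larger and the same bound applies.

The metric properties of the trace distance rest on duality: the trace norm of `a` is the maximum of
`|tr (c a)|` over contractions `c`. -/

/-! ### Integrability and Hoeffding's lemma. -/

theorem Continuous.integrable_of_compactSpace {X : Type*} [TopologicalSpace X] [CompactSpace X]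
    [MeasurableSpace X] [BorelSpace X] {f : X → ℝ} (hf : Continuous f) (ν : Measure X)
    [IsFiniteMeasure ν] : Integrable f ν :=
  hf.integrable_of_hasCompactSupport (HasCompactSupport.of_compactSpace f)

/-- Hoeffding's lemma on an interval of length `2 r`: `(2 r)² / 8 = r² / 2`. The centre `c` need not
be the mean. -/
theorem integral_exp_le_of_abs_sub_le {X : Type*} [MeasurableSpace X] (ν : Measure X)
    [IsProbabilityMeasure ν] {F : X → ℝ} (hF : Measurable F) {c r : ℝ}
    (hb : ∀ᵐ g ∂ν, |F g - c| ≤ r) :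
    ∫ g, Real.exp (F g) ∂ν ≤ Real.exp (r ^ 2 / 2) * Real.exp (∫ g, F g ∂ν) := by
  have h := (ProbabilityTheory.hasSubgaussianMGF_of_mem_Icc (μ := ν) (X := F) (a := c - r)
    (b := c + r) hF.aemeasurable (by
      filter_upwards [hb] with g hg
      rw [abs_le] at hg
      constructor <;> linarith [hg.1, hg.2])).mgf_le 1
  have hr : (‖c + r - (c - r)‖ / 2) ^ 2 = r ^ 2 := by
    have : c + r - (c - r) = 2 * r := by ring
    rw [this]
    simp
  simp only [ProbabilityTheory.mgf, one_mul, Real.exp_sub, integral_div] at h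
  rw [div_le_iff₀ (Real.exp_pos _)] at h
  push_cast at h
  rw [hr] at h
  simpa using h

/-! ### Bi-invariant pseudometrics. -/

section BiinvariantDist

variable {G : Type*} [Group G] [TopologicalSpace G]

/-- A continuous bi-invariant pseudometric on a topological group, as a two-variable function. -/
structure IsBiinvariantDist (d : G → G → ℝ) : Prop where
  continuous : Continuous fun p : G × G => d p.1 p.2
  self : ∀ x, d x x = 0
  symm : ∀ x y, d x y = d y x
  triangle : ∀ x y z, d x z ≤ d x y + d y z
  mul_left : ∀ g x y, d (g * x) (g * y) = d x y
  mul_right : ∀ g x y, d (x * g) (y * g) = d x y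

namespace IsBiinvariantDist

variable {d : G → G → ℝ}

theorem nonneg (hd : IsBiinvariantDist d) (x y : G) : 0 ≤ d x y := by
  have := hd.triangle x y x
  rw [hd.self, hd.symm y x] at this
  linarith

theorem continuous_of_lipschitz (hd : IsBiinvariantDist d) {f : G → ℝ} {L : ℝ}
    (hf : ∀ x y, |f x - f y| ≤ L * d x y) : Continuous f := by
  rw [continuous_iff_continuousAt]
  intro x
  rw [ContinuousAt, tendsto_iff_dist_tendsto_zero]
  have h0 : Tendsto (fun y => L * d y x) (𝓝 x) (𝓝 0) := by
    have : Continuous fun y => L * d y x :=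
      continuous_const.mul (hd.continuous.comp (continuous_id.prodMk continuous_const))
    simpa [hd.self] using this.tendsto x
  exact squeeze_zero (fun _ => dist_nonneg) (fun y => hf y x) h0

end IsBiinvariantDist

end BiinvariantDist

/-! ### The martingale method on a compact group. -/

section CompactGroup

variable {G : Type*} [Group G] [TopologicalSpace G] [IsTopologicalGroup G] [CompactSpace G]
  [MeasurableSpace G] [BorelSpace G]

theorem isProbabilityMeasure_haarMeasure_top :
    IsProbabilityMeasure (Measure.haarMeasure (⊤ : TopologicalSpace.PositiveCompacts G)) :=
  ⟨by simpa using Measure.haarMeasure_self (K₀ := (⊤ : TopologicalSpace.PositiveCompacts G))⟩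

/-- A right translate of `μ` is again a Haar probability measure, hence equals `μ` by uniqueness. -/
theorem isMulRightInvariant_of_isHaarMeasure_of_isProbabilityMeasure (μ : Measure G)
    [μ.IsHaarMeasure] [IsProbabilityMeasure μ] : μ.IsMulRightInvariant := by
  refine ⟨fun g => ?_⟩
  have : IsProbabilityMeasure (μ.map (· * g)) :=
    Measure.isProbabilityMeasure_map (measurable_mul_const g).aemeasurable
  exact Measure.isHaarMeasure_eq_of_isProbabilityMeasure _ _

/-- `ν` is a probability measure concentrated on the subgroup `H` and invariant under left and
right translations by elements of `H`. -/
structure IsSubgroupHaar (H : Subgroup G) (ν : Measure G) : Prop where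
  isProbabilityMeasure : IsProbabilityMeasure ν
  ae_mem : ∀ᵐ g ∂ν, g ∈ H
  map_mul_left : ∀ h ∈ H, ν.map (h * ·) = ν
  map_mul_right : ∀ h ∈ H, ν.map (· * h) = ν

/-- The Haar measure of `H` is pushed forward to `G`, so that measures of different subgroups live
on one space. -/
theorem exists_isSubgroupHaar (H : Subgroup G) (hH : IsClosed (H : Set G)) :
    ∃ ν : Measure G, IsSubgroupHaar H ν := by
  have : CompactSpace H := isCompact_iff_compactSpace.mp hH.isCompact
  set m : Measure H := Measure.haarMeasure ⊤
  have hm : IsProbabilityMeasure m := isProbabilityMeasure_haarMeasure_top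
  have hr := isMulRightInvariant_of_isHaarMeasure_of_isProbabilityMeasure m
  have hmeas : Measurable (Subtype.val : H → G) := measurable_subtype_coe
  refine ⟨m.map Subtype.val, Measure.isProbabilityMeasure_map hmeas.aemeasurable, ?_, ?_, ?_⟩
  · change ∀ᵐ g ∂_, g ∈ (H : Set G)
    refine (ae_map_iff hmeas.aemeasurable hH.measurableSet).mpr ?_
    exact ae_of_all _ fun h => h.2
  · intro h hh
    conv_rhs => rw [← map_mul_left_eq_self m ⟨h, hh⟩]
    rw [Measure.map_map (measurable_const_mul h) hmeas,
      Measure.map_map hmeas (measurable_const_mul _)]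
    rfl
  · intro h hh
    conv_rhs => rw [← map_mul_right_eq_self m ⟨h, hh⟩]
    rw [Measure.map_map (measurable_mul_const h) hmeas,
      Measure.map_map hmeas (measurable_mul_const _)]
    rfl

namespace IsSubgroupHaar

variable {H : Subgroup G} {ν : Measure G}

omit [CompactSpace G] in
theorem integral_mul_left (hν : IsSubgroupHaar H ν) {h : G} (hh : h ∈ H) {f : G → ℝ}
    (hf : Continuous f) : ∫ g, f (h * g) ∂ν = ∫ g, f g ∂ν := by
  conv_rhs => rw [← hν.map_mul_left h hh]
  rw [integral_map (measurable_const_mul h).aemeasurable hf.measurable.aestronglyMeasurable]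

omit [CompactSpace G] in
theorem integral_mul_right (hν : IsSubgroupHaar H ν) {h : G} (hh : h ∈ H) {f : G → ℝ}
    (hf : Continuous f) : ∫ g, f (g * h) ∂ν = ∫ g, f g ∂ν := by
  conv_rhs => rw [← hν.map_mul_right h hh]
  rw [integral_map (measurable_mul_const h).aemeasurable hf.measurable.aestronglyMeasurable]

end IsSubgroupHaar

theorem lipschitz_integral_mul {d : G → G → ℝ} (hd : IsBiinvariantDist d) (ν : Measure G)
    [IsProbabilityMeasure ν] {f : G → ℝ} {L : ℝ} (hf : ∀ x y, |f x - f y| ≤ L * d x y) (x y : G) :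
    |∫ g, f (x * g) ∂ν - ∫ g, f (y * g) ∂ν| ≤ L * d x y := by
  have hc := hd.continuous_of_lipschitz hf
  have hi : ∀ z, Integrable (fun g => f (z * g)) ν := fun z =>
    (hc.comp (continuous_const_mul z)).integrable_of_compactSpace ν
  rw [← integral_sub (hi x) (hi y)]
  have := norm_integral_le_of_norm_le_const (μ := ν) (f := fun g => f (x * g) - f (y * g))
    (C := L * d x y) (ae_of_all _ fun g => by
      simpa [hd.mul_right] using hf (x * g) (y * g))
  simpa using this

/-- One step of the martingale method along a chain of subgroups. -/
theorem integral_exp_average_le [SecondCountableTopology G] {d : G → G → ℝ}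
    (hd : IsBiinvariantDist d) (μ : Measure G)
    [IsProbabilityMeasure μ] [μ.IsMulRightInvariant] {H K : Subgroup G} {νH νK : Measure G}
    (hH : IsSubgroupHaar H νH) (hK : IsSubgroupHaar K νK) (hKH : K ≤ H) {a : ℝ}
    (hstep : ∀ h ∈ H, ∃ w, d w 1 ≤ a ∧ w⁻¹ * h ∈ K) {f : G → ℝ} {L : ℝ} (hL : 0 ≤ L)
    (hf : ∀ x y, |f x - f y| ≤ L * d x y) :
    ∫ x, Real.exp (∫ g, f (x * g) ∂νK) ∂μ ≤
      Real.exp ((L * a) ^ 2 / 2) * ∫ x, Real.exp (∫ g, f (x * g) ∂νH) ∂μ := by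
  have := hH.isProbabilityMeasure
  have := hK.isProbabilityMeasure
  have hfc := hd.continuous_of_lipschitz hf
  set F : G → ℝ := fun x => ∫ g, f (x * g) ∂νK with hFdef
  set E : G → ℝ := fun x => ∫ g, f (x * g) ∂νH with hEdef
  have hFl : ∀ x y, |F x - F y| ≤ L * d x y := lipschitz_integral_mul hd νK hf
  have hFc : Continuous F := hd.continuous_of_lipschitz hFl
  have hEc : Continuous E := hd.continuous_of_lipschitz (lipschitz_integral_mul hd νH hf)
  -- `F` is constant on left cosets of `K`, so `h` may be replaced by the representative `w` of `h
  -- K` near `1`.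
  have hosc : ∀ x, ∀ h ∈ H, |F (x * h) - F x| ≤ L * a := by
    intro x h hh
    obtain ⟨w, hw, hk⟩ := hstep h hh
    have h1 : F (x * h) = F (x * w) := by
      have := hK.integral_mul_left hk (hfc.comp (continuous_const_mul (x * w)))
      simp only [Function.comp_def] at this
      simp only [hFdef, ← this]
      congr 1; ext g; congr 1; group
    rw [h1]
    calc |F (x * w) - F x| ≤ L * d (x * w) x := hFl _ _
      _ = L * d w 1 := by
        have := hd.mul_left x w 1
        rw [mul_one] at this
        rw [this]
      _ ≤ L * a := by gcongr
  -- Tower property: the inner average over `K ≤ H` is absorbed by right invariance of `νH`.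
  have hEF : ∀ x, ∫ h, F (x * h) ∂νH = E x := by
    intro x
    simp only [hFdef]
    rw [integral_integral_swap]
    · have : ∀ᵐ g ∂νK, ∫ h, f (x * h * g) ∂νH = E x := by
        filter_upwards [hK.ae_mem] with g hg
        have := hH.integral_mul_right (hKH hg) (hfc.comp (continuous_const_mul x))
        simp only [Function.comp_def] at this
        simp only [hEdef, ← this, mul_assoc]
      rw [integral_congr_ae this]
      simp
    · have : Continuous (Function.uncurry fun h g => f (x * h * g)) := by
        unfold Function.uncurry; fun_prop
      exact this.integrable_of_hasCompactSupport (HasCompactSupport.of_compactSpace _)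
  -- Right invariance of `μ` disintegrates the integral over cosets of `H`, where Hoeffding's lemma
  -- applies.
  have hswap : ∫ x, Real.exp (F x) ∂μ = ∫ x, ∫ h, Real.exp (F (x * h)) ∂νH ∂μ := by
    rw [integral_integral_swap]
    · have : ∀ h, ∫ x, Real.exp (F (x * h)) ∂μ = ∫ x, Real.exp (F x) ∂μ := fun h =>
        integral_mul_right_eq_self (fun x => Real.exp (F x)) h
      simp [this]
    · have : Continuous (Function.uncurry fun x h => Real.exp (F (x * h))) := by
        unfold Function.uncurry; fun_prop
      exact this.integrable_of_hasCompactSupport (HasCompactSupport.of_compactSpace _)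
  rw [hswap, ← integral_const_mul]
  have hpt : ∀ x, ∫ h, Real.exp (F (x * h)) ∂νH ≤
      Real.exp ((L * a) ^ 2 / 2) * Real.exp (E x) := by
    intro x
    rw [← hEF x]
    refine integral_exp_le_of_abs_sub_le νH (hFc.comp (continuous_const_mul x)).measurable
      (c := F x) ?_
    filter_upwards [hH.ae_mem] with h hh using hosc x h hh
  refine integral_mono_of_nonneg (ae_of_all _ fun x => integral_nonneg fun h => (Real.exp_pos _).le)
    ?_ (ae_of_all _ hpt)
  exact (continuous_const.mul (Real.continuous_exp.comp hEc)).integrable_of_compactSpace μ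

/-- Subgaussian Laplace transforms of Lipschitz functions on a compact group of finite length. -/
theorem exists_integral_exp_le [SecondCountableTopology G] {d : G → G → ℝ}
    (hd : IsBiinvariantDist d) (μ : Measure G)
    [IsProbabilityMeasure μ] [μ.IsMulRightInvariant] (H : ℕ → Subgroup G)
    (hclosed : ∀ k, IsClosed (H k : Set G)) (hanti : Antitone H) (htop : H 0 = ⊤) {N : ℕ}
    (hbot : H N = ⊥) {a : ℝ}
    (hstep : ∀ k < N, ∀ h ∈ H k, ∃ w, d w 1 ≤ a ∧ w⁻¹ * h ∈ H (k + 1)) :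
    ∃ ν : Measure G, ∀ (f : G → ℝ) (L : ℝ), 0 ≤ L → (∀ x y, |f x - f y| ≤ L * d x y) →
      ∫ x, Real.exp (f x) ∂μ ≤ Real.exp (N * ((L * a) ^ 2 / 2)) * Real.exp (∫ g, f g ∂ν) := by
  choose ν hν using fun k => exists_isSubgroupHaar (H k) (hclosed k)
  refine ⟨ν 0, fun f L hL hf => ?_⟩
  have := fun k => (hν k).isProbabilityMeasure
  have hfc := hd.continuous_of_lipschitz hf
  have hind : ∀ k ≤ N, ∫ x, Real.exp (∫ g, f (x * g) ∂ν k) ∂μ ≤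
      Real.exp (k * ((L * a) ^ 2 / 2)) * Real.exp (∫ g, f g ∂ν 0) := by
    intro k
    induction k with
    | zero =>
      intro _
      have : ∀ x, ∫ g, f (x * g) ∂ν 0 = ∫ g, f g ∂ν 0 := fun x =>
        (hν 0).integral_mul_left (by simp [htop]) hfc
      simp [this]
    | succ k ih =>
      intro hk
      refine (integral_exp_average_le hd μ (hν k) (hν (k + 1)) (hanti k.le_succ)
        (hstep k hk) hL hf).trans ?_
      refine (mul_le_mul_of_nonneg_left (ih (by omega)) (Real.exp_pos _).le).trans_eq ?_
      rw [← mul_assoc, ← Real.exp_add]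
      push_cast
      ring_nf
  have hN : ∀ x, ∫ g, f (x * g) ∂ν N = f x := by
    intro x
    have : ∀ᵐ g ∂ν N, f (x * g) = f x := by
      filter_upwards [(hν N).ae_mem] with g hg
      rw [hbot, Subgroup.mem_bot] at hg
      simp [hg]
    rw [integral_congr_ae this]
    simp
  simpa [hN] using hind N le_rfl

/-- Concentration of measure on a compact group of length at most `a √N`. -/
theorem one_sub_le_measureReal_nbhd [SecondCountableTopology G] {d : G → G → ℝ}
    (hd : IsBiinvariantDist d) (μ : Measure G)
    [IsProbabilityMeasure μ] [μ.IsMulRightInvariant] (H : ℕ → Subgroup G)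
    (hclosed : ∀ k, IsClosed (H k : Set G)) (hanti : Antitone H) (htop : H 0 = ⊤) {N : ℕ}
    (hN : 0 < N) (hbot : H N = ⊥) {a : ℝ} (ha : 0 < a)
    (hstep : ∀ k < N, ∀ h ∈ H k, ∃ w, d w 1 ≤ a ∧ w⁻¹ * h ∈ H (k + 1))
    {ε : ℝ} (hε : 0 < ε) {A : Set G} (hμA : 1 / 2 ≤ μ.real A) :
    1 - 2 * Real.exp (-(ε ^ 2 / (4 * N * a ^ 2))) ≤ μ.real (nbhd d ε A) := by
  obtain ⟨ν, hν⟩ := exists_integral_exp_le hd μ H hclosed hanti htop hbot hstep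
  have hne : Nonempty A := by
    by_contra h
    rw [Set.not_nonempty_iff_eq_empty'.mp h] at hμA
    norm_num at hμA
  -- The distance to `A`: it is 1-Lipschitz, vanishes on `A`, and is at least `ε` exactly off the
  -- neighbourhood.
  set f : G → ℝ := fun x => ⨅ y : A, d x y with hfdef
  have hbdd : ∀ x, BddBelow (Set.range fun y : A => d x y) := fun x =>
    ⟨0, by rintro _ ⟨y, rfl⟩; exact hd.nonneg _ _⟩
  have hf0 : ∀ x, 0 ≤ f x := fun x => le_ciInf fun y => hd.nonneg _ _
  have hfA : ∀ x ∈ A, f x = 0 := fun x hx =>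
    le_antisymm ((ciInf_le (hbdd x) ⟨x, hx⟩).trans_eq (hd.self x)) (hf0 x)
  have hfle : ∀ x y, f x - f y ≤ d x y := by
    intro x y
    rw [sub_le_iff_le_add', ← sub_le_iff_le_add]
    refine le_ciInf fun z => ?_
    have := ciInf_le (hbdd x) z
    have := hd.triangle x y z
    simp only [hfdef]
    linarith
  have hfl : ∀ x y, |f x - f y| ≤ d x y := fun x y =>
    abs_sub_le_iff.mpr ⟨hfle x y, by rw [hd.symm]; exact hfle y x⟩
  have hfc : Continuous f := hd.continuous_of_lipschitz (L := 1) (by simpa using hfl)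
  have hfε : (nbhd d ε A)ᶜ = {x | ε ≤ f x} := by
    ext x
    simp only [nbhd, Set.mem_compl_iff, Set.mem_ofPred_eq, not_exists, not_and, not_lt, hfdef]
    constructor
    · intro h
      exact le_ciInf fun y => h y y.2
    · intro h y hy
      exact h.trans (ciInf_le (hbdd x) ⟨y, hy⟩)
  have hmB : MeasurableSet {x | ε ≤ f x} := (isClosed_le continuous_const hfc).measurableSet
  have hmn : MeasurableSet (nbhd d ε A) := by
    rw [← compl_compl (nbhd d ε A), hfε]
    exact hmB.compl
  -- The minimizer of `N a² l² - l ε`, the exponent left after the two Laplace bounds are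
  -- multiplied.
  set l : ℝ := ε / (2 * N * a ^ 2) with hl
  have hN' : (0 : ℝ) < N := by exact_mod_cast hN
  have hl0 : 0 ≤ l := by positivity
  have hlf : ∀ s : ℝ, |s| = l → ∀ x y, |s * f x - s * f y| ≤ l * d x y := by
    intro s hs x y
    rw [← mul_sub, abs_mul, hs]
    exact mul_le_mul_of_nonneg_left (hfl x y) hl0
  have h1 := hν (fun x => l * f x) l hl0 (hlf l (abs_of_nonneg hl0))
  have h2 := hν (fun x => -l * f x) l hl0 (hlf (-l) (by rw [abs_neg, abs_of_nonneg hl0]))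
  rw [integral_const_mul] at h1 h2
  have hi : ∀ s : ℝ, Integrable (fun x => Real.exp (s * f x)) μ := fun s =>
    Continuous.integrable_of_compactSpace (by fun_prop) μ
  have hB : Real.exp (l * ε) * μ.real {x | ε ≤ f x} ≤ ∫ x, Real.exp (l * f x) ∂μ := by
    refine le_trans ?_ (mul_meas_ge_le_integral_of_nonneg
      (ae_of_all _ fun x => (Real.exp_pos _).le) (hi l) (Real.exp (l * ε)))
    refine mul_le_mul_of_nonneg_left (measureReal_mono fun x hx => ?_) (Real.exp_pos _).le
    exact Real.exp_le_exp.mpr (mul_le_mul_of_nonneg_left hx hl0)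
  have hA2 : 1 / 2 ≤ ∫ x, Real.exp (-l * f x) ∂μ := by
    have h3 := mul_meas_ge_le_integral_of_nonneg (μ := μ)
      (ae_of_all _ fun x => (Real.exp_pos (-l * f x)).le) (hi (-l)) 1
    rw [one_mul] at h3
    refine hμA.trans (le_trans (measureReal_mono fun x hx => ?_) h3)
    simp [hfA x hx]
  set T : ℝ := Real.exp (N * ((l * a) ^ 2 / 2)) with hT
  set C : ℝ := ∫ g, f g ∂ν
  -- The two bounds share the same mean `C`, so its exponentials cancel in the product.
  have hprod : Real.exp (l * ε) * μ.real {x | ε ≤ f x} * (1 / 2) ≤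
      (T * Real.exp (l * C)) * (T * Real.exp (-l * C)) := by
    have := hB.trans h1
    have := hA2.trans h2
    gcongr
  have hval : (T * Real.exp (l * C)) * (T * Real.exp (-l * C)) =
      Real.exp (l * ε) * Real.exp (-(ε ^ 2 / (4 * N * a ^ 2))) := by
    rw [hT]
    simp only [← Real.exp_add]
    congr 1
    rw [hl]
    field_simp
    ring
  rw [hval, mul_assoc] at hprod
  have h4 := le_of_mul_le_mul_left hprod (Real.exp_pos _)
  have h5 : μ.real (nbhd d ε A)ᶜ = 1 - μ.real (nbhd d ε A) := probReal_compl_eq_one_sub hmn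
  rw [hfε] at h5
  linarith

end CompactGroup

/-! ### The trace norm and its duality with contractions. -/

section TraceNorm

open Matrix
open scoped ComplexOrder

variable {ι : Type*} [Fintype ι] [DecidableEq ι]

/-- The trace norm `tr |a|`. -/
noncomputable def traceNorm (a : Matrix ι ι ℂ) : ℝ := (trace (CFC.abs a)).re

/-- A singular value decomposition without the left factor: `U` diagonalizes `|a|`, and the columns
of `a U` are orthogonal with norms `s i`. -/
theorem exists_unitary_diagonal_cfcAbs (a : Matrix ι ι ℂ) :
    ∃ (U : Matrix ι ι ℂ) (s : ι → ℝ), Uᴴ * U = 1 ∧ U * Uᴴ = 1 ∧ (∀ i, 0 ≤ s i) ∧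
      CFC.abs a = U * diagonal (fun i => (s i : ℂ)) * Uᴴ ∧
      (a * U)ᴴ * (a * U) = diagonal (fun i => (s i : ℂ) ^ 2) := by
  have hpos : (CFC.abs a).PosSemidef := Matrix.nonneg_iff_posSemidef.mp (CFC.abs_nonneg a)
  have h := hpos.isHermitian.spectral_theorem
  rw [Unitary.conjStarAlgAut_apply] at h
  set U : Matrix ι ι ℂ := (hpos.isHermitian.eigenvectorUnitary : Matrix ι ι ℂ) with hU
  have h1 : Uᴴ * U = 1 := Unitary.coe_star_mul_self hpos.isHermitian.eigenvectorUnitary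
  have h2 : U * Uᴴ = 1 := Unitary.coe_mul_star_self hpos.isHermitian.eigenvectorUnitary
  obtain ⟨s, hs, h3⟩ : ∃ s : ι → ℝ, (∀ i, 0 ≤ s i) ∧
      CFC.abs a = U * diagonal (fun i => (s i : ℂ)) * Uᴴ :=
    ⟨hpos.isHermitian.eigenvalues, fun i => hpos.eigenvalues_nonneg i, h⟩
  refine ⟨U, s, h1, h2, hs, h3, ?_⟩
  have h4 : aᴴ * a = CFC.abs a * CFC.abs a := (CFC.abs_mul_abs a).symm
  calc (a * U)ᴴ * (a * U) = Uᴴ * (aᴴ * a) * U := by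
        simp only [conjTranspose_mul, Matrix.mul_assoc]
    _ = (Uᴴ * U) * diagonal (fun i => (s i : ℂ)) * (Uᴴ * U) *
          diagonal (fun i => (s i : ℂ)) * (Uᴴ * U) := by
        rw [h4, h3]
        simp only [Matrix.mul_assoc]
    _ = _ := by
        rw [h1, Matrix.one_mul, Matrix.mul_one, Matrix.mul_one, diagonal_mul_diagonal]
        simp only [sq]

theorem trace_conj_unitary {U D : Matrix ι ι ℂ} (hU : Uᴴ * U = 1) :
    trace (U * D * Uᴴ) = trace D := by
  rw [Matrix.mul_assoc, trace_mul_comm, Matrix.mul_assoc, hU, Matrix.mul_one]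

omit [DecidableEq ι] in
theorem sum_norm_sq_row (c : Matrix ι ι ℂ) (i : ι) :
    ((∑ j, ‖c i j‖ ^ 2 : ℝ) : ℂ) = (c * cᴴ) i i := by
  simp [Matrix.mul_apply, ← Complex.mul_conj']

omit [DecidableEq ι] in
theorem sum_norm_sq_col (c : Matrix ι ι ℂ) (i : ι) :
    ((∑ j, ‖c j i‖ ^ 2 : ℝ) : ℂ) = (cᴴ * c) i i := by
  simp [Matrix.mul_apply, ← Complex.conj_mul']

omit [DecidableEq ι] in
theorem re_trace_conjTranspose_mul_self (a : Matrix ι ι ℂ) :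
    (trace (aᴴ * a)).re = ∑ i, ∑ j, ‖a j i‖ ^ 2 := by
  have : trace (aᴴ * a) = ((∑ i, ∑ j, ‖a j i‖ ^ 2 : ℝ) : ℂ) := by
    rw [Complex.ofReal_sum]
    exact Finset.sum_congr rfl fun i _ => (sum_norm_sq_col a i).symm
  rw [this, Complex.ofReal_re]

/-- The upper half of duality. In the basis `U`, Cauchy–Schwarz bounds each diagonal entry: the rows
of `Uᴴ c` have norm at most `1`, the columns of `a U` have norm `s i`. -/
theorem norm_trace_mul_le_traceNorm {c : Matrix ι ι ℂ} (hc : (1 - c * cᴴ).PosSemidef)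
    (a : Matrix ι ι ℂ) : ‖trace (c * a)‖ ≤ traceNorm a := by
  obtain ⟨U, s, h1, h2, hs, habs, hsq⟩ := exists_unitary_diagonal_cfcAbs a
  have htr : traceNorm a = ∑ i, s i := by
    rw [traceNorm, habs, trace_conj_unitary h1, trace_diagonal]
    simp
  have hrow : ∀ i, ∑ j, ‖(Uᴴ * c) i j‖ ^ 2 ≤ 1 := by
    intro i
    have := (hc.conjTranspose_mul_mul_same U).diag_nonneg (i := i)
    have h3 : Uᴴ * (1 - c * cᴴ) * U = 1 - (Uᴴ * c) * (Uᴴ * c)ᴴ := by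
      simp only [Matrix.mul_sub, Matrix.sub_mul, Matrix.mul_one, h1, conjTranspose_mul,
        conjTranspose_conjTranspose, Matrix.mul_assoc]
    rw [h3, Matrix.sub_apply, Matrix.one_apply_eq, ← sum_norm_sq_row, sub_nonneg] at this
    exact_mod_cast this
  have hcol : ∀ i, ∑ j, ‖(a * U) j i‖ ^ 2 = s i ^ 2 := by
    intro i
    have := sum_norm_sq_col (a * U) i
    rw [hsq, diagonal_apply_eq] at this
    exact_mod_cast this
  have hprod : trace (c * a) = trace ((Uᴴ * c) * (a * U)) := by
    rw [← Matrix.mul_assoc, trace_mul_comm _ U, ← Matrix.mul_assoc, ← Matrix.mul_assoc, h2,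
      Matrix.one_mul]
  rw [hprod, htr, trace]
  refine (norm_sum_le _ _).trans (Finset.sum_le_sum fun i _ => ?_)
  rw [diag_apply, Matrix.mul_apply]
  refine (norm_sum_le _ _).trans (abs_le_of_sq_le_sq' ?_ (hs i)).2
  simp only [norm_mul]
  calc _ ≤ (∑ j, ‖(Uᴴ * c) i j‖ ^ 2) * ∑ j, ‖(a * U) j i‖ ^ 2 :=
        Finset.sum_mul_sq_le_sq_mul_sq _ _ _
    _ ≤ 1 * s i ^ 2 := by
        rw [hcol]
        exact mul_le_mul_of_nonneg_right (hrow i) (sq_nonneg _)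
    _ = s i ^ 2 := one_mul _

/-- Duality is attained at the adjoint of the partial isometry in the polar decomposition of `a`. -/
theorem exists_contraction_mul_eq_cfcAbs (a : Matrix ι ι ℂ) :
    ∃ c : Matrix ι ι ℂ, (1 - c * cᴴ).PosSemidef ∧ c * a = CFC.abs a := by
  obtain ⟨U, s, h1, h2, hs, habs, hsq⟩ := exists_unitary_diagonal_cfcAbs a
  have haU : a = (a * U) * Uᴴ := by rw [Matrix.mul_assoc, h2, Matrix.mul_one]
  have hD : (diagonal fun i => ((s i : ℂ))⁻¹)ᴴ = diagonal fun i => ((s i : ℂ))⁻¹ := by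
    rw [diagonal_conjTranspose]
    congr 1; ext i; simp
  -- The convention `0⁻¹ = 0` makes this work for singular `a`; then `1 - c cᴴ` is the projection
  -- onto the kernel of `a`.
  refine ⟨U * diagonal (fun i => ((s i : ℂ))⁻¹) * (a * U)ᴴ, ?_, ?_⟩
  · have : 1 - U * diagonal (fun i => ((s i : ℂ))⁻¹) * (a * U)ᴴ *
        (U * diagonal (fun i => ((s i : ℂ))⁻¹) * (a * U)ᴴ)ᴴ =
        U * diagonal (fun i => if s i = 0 then (1 : ℂ) else 0) * Uᴴ := by
      calc _ = 1 - U * diagonal (fun i => ((s i : ℂ))⁻¹) * ((a * U)ᴴ * (a * U)) *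
              diagonal (fun i => ((s i : ℂ))⁻¹) * Uᴴ := by
            rw [conjTranspose_mul _ (a * U)ᴴ, conjTranspose_mul U, conjTranspose_conjTranspose, hD]
            simp only [Matrix.mul_assoc]
        _ = U * (1 - diagonal (fun i => ((s i : ℂ))⁻¹) * ((a * U)ᴴ * (a * U)) *
              diagonal (fun i => ((s i : ℂ))⁻¹)) * Uᴴ := by
            rw [Matrix.mul_sub, Matrix.sub_mul, Matrix.mul_one, h2]
            simp only [Matrix.mul_assoc]
        _ = _ := by
            rw [hsq, diagonal_mul_diagonal, diagonal_mul_diagonal, ← diagonal_one,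
              diagonal_sub]
            congr 3
            ext i
            by_cases h : s i = 0
            · simp [h]
            · have : (s i : ℂ) ≠ 0 := by exact_mod_cast h
              simp only [h, if_false]
              field_simp
              simp
    rw [this]
    refine PosSemidef.mul_mul_conjTranspose_same (posSemidef_diagonal_iff.mpr fun i => ?_) U
    split_ifs <;> simp
  · conv_lhs => rw [haU]
    rw [habs]
    calc _ = U * (diagonal (fun i => ((s i : ℂ))⁻¹) * ((a * U)ᴴ * (a * U))) * Uᴴ := by
          conv_lhs => rw [← haU]
          conv_lhs => enter [2]; rw [haU]
          simp only [Matrix.mul_assoc]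
      _ = _ := by
          rw [hsq, diagonal_mul_diagonal]
          congr 3
          ext i
          by_cases h : s i = 0
          · simp [h]
          · have : (s i : ℂ) ≠ 0 := by exact_mod_cast h
            field_simp

theorem traceNorm_add_le (a b : Matrix ι ι ℂ) : traceNorm (a + b) ≤ traceNorm a + traceNorm b := by
  obtain ⟨c, hc, hca⟩ := exists_contraction_mul_eq_cfcAbs (a + b)
  rw [traceNorm, ← hca, Matrix.mul_add, trace_add, Complex.add_re]
  exact add_le_add ((Complex.re_le_norm _).trans (norm_trace_mul_le_traceNorm hc a))
    ((Complex.re_le_norm _).trans (norm_trace_mul_le_traceNorm hc b))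

theorem traceNorm_neg (a : Matrix ι ι ℂ) : traceNorm (-a) = traceNorm a := by
  rw [traceNorm, CFC.abs_neg, traceNorm]

/-- `|a|` depends only on `aᴴ a`, which a unitary factor on the left does not change. -/
theorem traceNorm_unitary_mul {u : Matrix ι ι ℂ} (hu : uᴴ * u = 1) (a : Matrix ι ι ℂ) :
    traceNorm (u * a) = traceNorm a := by
  have : star (u * a) * (u * a) = star a * a := by
    rw [star_eq_conjTranspose, star_eq_conjTranspose, conjTranspose_mul, Matrix.mul_assoc,
      ← Matrix.mul_assoc uᴴ, hu, Matrix.one_mul]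
  rw [traceNorm, CFC.abs, this, traceNorm, CFC.abs]

/-- Right multiplication can change `|a|`, so duality is used: by cyclicity of the trace, `u` moves
onto the contraction. -/
theorem traceNorm_mul_unitary_le {u : Matrix ι ι ℂ} (hu : u * uᴴ = 1) (a : Matrix ι ι ℂ) :
    traceNorm (a * u) ≤ traceNorm a := by
  obtain ⟨c, hc, hca⟩ := exists_contraction_mul_eq_cfcAbs (a * u)
  have hc' : (1 - (u * c) * (u * c)ᴴ).PosSemidef := by
    have h := hc.mul_mul_conjTranspose_same u
    have : u * (1 - c * cᴴ) * uᴴ = 1 - (u * c) * (u * c)ᴴ := by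
      simp only [Matrix.mul_sub, Matrix.sub_mul, Matrix.mul_one, hu, conjTranspose_mul,
        Matrix.mul_assoc]
    rwa [this] at h
  rw [traceNorm, ← hca, ← Matrix.mul_assoc, trace_mul_comm, ← Matrix.mul_assoc]
  exact (Complex.re_le_norm _).trans (norm_trace_mul_le_traceNorm hc' a)

theorem traceNorm_mul_unitary {u : Matrix ι ι ℂ} (hu : u * uᴴ = 1) (hu' : uᴴ * u = 1)
    (a : Matrix ι ι ℂ) : traceNorm (a * u) = traceNorm a := by
  refine le_antisymm (traceNorm_mul_unitary_le hu a) ?_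
  have := traceNorm_mul_unitary_le (u := uᴴ) (by rwa [conjTranspose_conjTranspose]) (a * u)
  rwa [Matrix.mul_assoc, hu, Matrix.mul_one] at this

theorem exists_singularValues (a : Matrix ι ι ℂ) : ∃ s : ι → ℝ, (∀ i, 0 ≤ s i) ∧
    traceNorm a = ∑ i, s i ∧ (trace (aᴴ * a)).re = ∑ i, s i ^ 2 := by
  obtain ⟨U, s, h1, h2, hs, habs, hsq⟩ := exists_unitary_diagonal_cfcAbs a
  refine ⟨s, hs, ?_, ?_⟩
  · rw [traceNorm, habs, trace_conj_unitary h1, trace_diagonal]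
    simp
  · have : trace (aᴴ * a) = trace ((a * U)ᴴ * (a * U)) := by
      rw [conjTranspose_mul, Matrix.mul_assoc, trace_mul_comm Uᴴ, Matrix.mul_assoc,
        Matrix.mul_assoc, h2, Matrix.mul_one]
    rw [this, hsq, trace_diagonal, Complex.re_sum]
    exact Finset.sum_congr rfl fun i _ => by norm_cast

theorem sqrt_re_trace_le_traceNorm (a : Matrix ι ι ℂ) :
    √(trace (aᴴ * a)).re ≤ traceNorm a := by
  obtain ⟨s, hs, h1, h2⟩ := exists_singularValues a
  rw [h1, h2]
  exact Real.sqrt_le_iff.mpr ⟨Finset.sum_nonneg fun i _ => hs i,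
    Finset.sum_sq_le_sq_sum_of_nonneg fun i _ => hs i⟩

theorem traceNorm_le_sqrt_card_mul (a : Matrix ι ι ℂ) :
    traceNorm a ≤ √(Fintype.card ι * (trace (aᴴ * a)).re) := by
  obtain ⟨s, hs, h1, h2⟩ := exists_singularValues a
  rw [h1, h2]
  exact Real.le_sqrt_of_sq_le sq_sum_le_card_mul_sum_sq

theorem traceNorm_zero : traceNorm (0 : Matrix ι ι ℂ) = 0 := by
  simp [traceNorm]

theorem traceNorm_smul_vecMulVec (c : ℂ) (p : ι → ℂ) :
    traceNorm (c • vecMulVec p (star p)) = ‖c‖ * (p ⬝ᵥ star p).re := by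
  have h : 0 ≤ vecMulVec p (star p) :=
    Matrix.nonneg_iff_posSemidef.mpr (posSemidef_vecMulVec_self_star p)
  rw [traceNorm, CFC.abs_smul, CFC.abs_of_nonneg _ h, trace_smul, trace_vecMulVec]
  simp

end TraceNorm

/-! ### Complex reflections. -/

section Reflection

open Matrix
open scoped ComplexOrder

variable {ι : Type*} [Fintype ι] [DecidableEq ι]

theorem one_sub_smul_vecMulVec_mulVec (s : ℂ) (p v : ι → ℂ) :
    (1 - s • vecMulVec p (star p)) *ᵥ v = v - (s * (star p ⬝ᵥ v)) • p := by
  rw [sub_mulVec, one_mulVec, smul_mulVec, vecMulVec_mulVec]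
  ext i
  simp
  ring

/-- Since `(p p*)² = |p|² p p*`, the hypothesis is exactly what cancels the rank-one terms in the
expansion. -/
theorem one_sub_smul_vecMulVec_mul_conjTranspose (s : ℂ) (p : ι → ℂ)
    (h : s + star s = s * star s * (star p ⬝ᵥ p)) :
    (1 - s • vecMulVec p (star p)) * (1 - s • vecMulVec p (star p))ᴴ = 1 := by
  have h1 : (vecMulVec p (star p))ᴴ = vecMulVec p (star p) := by
    rw [conjTranspose_vecMulVec, star_star]
  have h2 : vecMulVec p (star p) * vecMulVec p (star p) =
      (star p ⬝ᵥ p) • vecMulVec p (star p) := by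
    rw [vecMulVec_mul_vecMulVec]
    ext i j
    simp [vecMulVec_apply]
    ring
  rw [conjTranspose_sub, conjTranspose_one, conjTranspose_smul, h1]
  simp only [Matrix.sub_mul, Matrix.mul_sub, Matrix.one_mul, Matrix.mul_one, Matrix.smul_mul,
    Matrix.mul_smul, h2, smul_smul]
  have : s + star s - s * (star s * (star p ⬝ᵥ p)) = 0 := by rw [h]; ring
  ext i j
  simp only [Matrix.sub_apply, Matrix.smul_apply, smul_eq_mul]
  linear_combination -(vecMulVec p (star p) i j) * this

/-- A complex reflection carrying a unit vector to another one. -/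
theorem exists_unitary_mulVec_eq {x e : ι → ℂ} (hx : star x ⬝ᵥ x = 1) (he : star e ⬝ᵥ e = 1) :
    ∃ w ∈ unitaryGroup ι ℂ, w *ᵥ e = x ∧ (∀ v, star (x - e) ⬝ᵥ v = 0 → w *ᵥ v = v) ∧
      traceNorm (w - 1) ≤ 2 := by
  set z : ℂ := star x ⬝ᵥ e with hz
  have hz' : star e ⬝ᵥ x = star z := by rw [hz, ← star_dotProduct_star, star_star, dotProduct_comm]
  have hpe : star (x - e) ⬝ᵥ e = z - 1 := by rw [star_sub, sub_dotProduct, he]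
  have hpp : star (x - e) ⬝ᵥ (x - e) = (1 - z) + star (1 - z) := by
    rw [dotProduct_sub, hpe, star_sub, sub_dotProduct, hx, hz', star_sub, star_one]
    ring
  by_cases h1 : 1 - z = 0
  · have hxe : x = e := by
      rw [h1, star_zero, add_zero, dotProduct_star_self_eq_zero] at hpp
      exact sub_eq_zero.mp hpp
    refine ⟨1, one_mem _, by rw [one_mulVec, hxe], fun v _ => one_mulVec v, ?_⟩
    rw [sub_self, traceNorm_zero]
    norm_num
  · have h1' : star (1 - z) ≠ 0 := star_ne_zero.mpr h1
    -- The complex factor `(1 - z)⁻¹` is forced by `w e = x`; a real Householder factor would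
    -- suffice only for real `z`.
    refine ⟨1 - (1 - z)⁻¹ • vecMulVec (x - e) (star (x - e)), ?_, ?_, ?_, ?_⟩
    · rw [mem_unitaryGroup_iff]
      refine one_sub_smul_vecMulVec_mul_conjTranspose _ _ ?_
      rw [hpp, star_inv₀]
      field_simp
      ring
    · rw [one_sub_smul_vecMulVec_mulVec, hpe]
      have : (1 - z)⁻¹ * (z - 1) = -1 := by
        rw [← neg_sub 1 z, mul_neg, inv_mul_cancel₀ h1]
      rw [this]
      simp
    · intro v hv
      rw [one_sub_smul_vecMulVec_mulVec, hv]
      simp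
    · rw [sub_sub_cancel_left, traceNorm_neg, traceNorm_smul_vecMulVec, dotProduct_comm, hpp,
        norm_inv, inv_mul_le_iff₀ (norm_pos_iff.mpr h1)]
      -- The trace norm is `|x - e|² / |1 - z| = 2 Re (1 - z) / |1 - z|`, hence at most `2`.
      have h2 : (1 - z + star (1 - z)).re = 2 * (1 - z).re := by
        simp
        ring
      rw [h2, mul_comm]
      exact mul_le_mul_of_nonneg_right (Complex.re_le_norm _) zero_le_two

end Reflection

/-! ### Continuous metrics on compact spaces. -/

theorem continuous_of_tendsto_dist {X Y : Type*} [TopologicalSpace X] [PseudoMetricSpace Y]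
    {f : X → Y} (h : ∀ x, Tendsto (fun y => dist (f y) (f x)) (𝓝 x) (𝓝 0)) : Continuous f :=
  continuous_iff_continuousAt.mpr fun x => tendsto_iff_dist_tendsto_zero.mpr (h x)

/-- The identity from the compact topology to the Hausdorff metric topology is continuous, hence a
homeomorphism, so the two Borel structures agree. -/
theorem isMMSpace_of_continuous {X : Type*} [TopologicalSpace X] [CompactSpace X]
    [MeasurableSpace X] [BorelSpace X] {d : X → X → ℝ}
    (hc : Continuous fun p : X × X => d p.1 p.2) (hself : ∀ x, d x x = 0)
    (hsymm : ∀ x y, d x y = d y x) (htri : ∀ x y z, d x z ≤ d x y + d y z)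
    (heq : ∀ x y, d x y = 0 → x = y) (μ : Measure X) [IsProbabilityMeasure μ] :
    IsMMSpace d μ := by
  refine ⟨?_, inferInstance⟩
  let m : MetricSpace X :=
    { dist := d
      dist_self := hself
      dist_comm := hsymm
      dist_triangle := htri
      eq_of_dist_eq_zero := fun {x y} h => heq x y h }
  refine ⟨m, fun _ _ => rfl, ?_⟩
  rename_i t _ _ _ _
  have hid : @Continuous X X t m.toUniformSpace.toTopologicalSpace id := by
    refine @continuous_of_tendsto_dist X X t m.toPseudoMetricSpace id fun x => ?_
    have h : @Continuous X ℝ t _ fun y => d y x :=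
      hc.comp ((@continuous_id X t).prodMk (@continuous_const X X t t x))
    have h' := @Continuous.tendsto X ℝ t _ _ h x
    simp only [hself] at h'
    exact h'
  have hle : t ≤ m.toUniformSpace.toTopologicalSpace := continuous_id_iff_le.mp hid
  have hge : m.toUniformSpace.toTopologicalSpace ≤ t := by
    rw [← continuous_id_iff_le]
    exact @Continuous.continuous_symm_of_equiv_compact_to_t2 X X t
      m.toUniformSpace.toTopologicalSpace _ _ (Equiv.refl X) hid
  have : m.toUniformSpace.toTopologicalSpace = t := le_antisymm hge hle
  rw [this]
  infer_instance

/-! ### The two metrics and the flag of stabilizers in the unitary group. -/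

section UnitaryGroup

open Matrix

variable (n : ℕ)

instance : SecondCountableTopology (UGroup n) := by
  have : SecondCountableTopology (Matrix (Fin n) (Fin n) ℂ) :=
    inferInstanceAs (SecondCountableTopology (Fin n → Fin n → ℂ))
  exact TopologicalSpace.Subtype.secondCountableTopology _

instance : IsProbabilityMeasure (haarU n) := isProbabilityMeasure_haarMeasure_top

instance : (haarU n).IsMulRightInvariant :=
  have : (haarU n).IsHaarMeasure := inferInstanceAs (Measure.haarMeasure ⊤).IsHaarMeasure
  isMulRightInvariant_of_isHaarMeasure_of_isProbabilityMeasure _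

variable {n}

theorem UGroup.conjTranspose_mul_self (u : UGroup n) : (u : Matrix (Fin n) (Fin n) ℂ)ᴴ * u = 1 :=
  mem_unitaryGroup_iff'.mp u.2

theorem UGroup.mul_conjTranspose_self (u : UGroup n) : (u : Matrix (Fin n) (Fin n) ℂ) * uᴴ = 1 :=
  mem_unitaryGroup_iff.mp u.2

theorem traceDist_eq (u v : UGroup n) :
    traceDist n u v =
      1 / n * traceNorm ((u : Matrix (Fin n) (Fin n) ℂ) - (v : Matrix (Fin n) (Fin n) ℂ)) :=
  rfl

theorem hilbertSchmidtDist_eq_norm (u v : UGroup n) : hilbertSchmidtDist n u v =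
    ‖(WithLp.toLp 2 fun p => (u : Matrix (Fin n) (Fin n) ℂ) p.2 p.1 :
        EuclideanSpace ℂ (Fin n × Fin n)) -
      WithLp.toLp 2 fun p => (v : Matrix (Fin n) (Fin n) ℂ) p.2 p.1‖ := by
  rw [EuclideanSpace.norm_eq, Fintype.sum_prod_type]
  exact congrArg Real.sqrt (re_trace_conjTranspose_mul_self _)

theorem hilbertSchmidtDist_self (u : UGroup n) : hilbertSchmidtDist n u u = 0 := by
  simp [hilbertSchmidtDist_eq_norm]

theorem hilbertSchmidtDist_comm (u v : UGroup n) :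
    hilbertSchmidtDist n u v = hilbertSchmidtDist n v u := by
  simp only [hilbertSchmidtDist_eq_norm]
  exact norm_sub_rev _ _

theorem hilbertSchmidtDist_triangle (u v w : UGroup n) :
    hilbertSchmidtDist n u w ≤ hilbertSchmidtDist n u v + hilbertSchmidtDist n v w := by
  simp only [hilbertSchmidtDist_eq_norm]
  exact norm_sub_le_norm_sub_add_norm_sub _ _ _

theorem eq_of_hilbertSchmidtDist_eq_zero {u v : UGroup n} (h : hilbertSchmidtDist n u v = 0) :
    u = v := by
  rw [hilbertSchmidtDist_eq_norm, norm_eq_zero, sub_eq_zero] at h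
  ext i j
  exact congrFun (congrArg WithLp.ofLp h) (j, i)

theorem continuous_hilbertSchmidtDist :
    Continuous fun p : UGroup n × UGroup n => hilbertSchmidtDist n p.1 p.2 := by
  unfold hilbertSchmidtDist
  fun_prop

theorem hilbertSchmidtDist_div_le_traceDist (u v : UGroup n) :
    hilbertSchmidtDist n u v / n ≤ traceDist n u v := by
  rw [traceDist_eq, div_eq_inv_mul, one_div]
  exact mul_le_mul_of_nonneg_left (sqrt_re_trace_le_traceNorm _) (by positivity)

theorem traceDist_le_hilbertSchmidtDist (u v : UGroup n) :
    traceDist n u v ≤ 1 / n * (√n * hilbertSchmidtDist n u v) := by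
  rw [traceDist_eq]
  refine mul_le_mul_of_nonneg_left ((traceNorm_le_sqrt_card_mul _).trans_eq ?_) (by positivity)
  rw [Fintype.card_fin, Real.sqrt_mul (Nat.cast_nonneg n)]
  rfl

theorem traceDist_self (u : UGroup n) : traceDist n u u = 0 := by
  rw [traceDist_eq, sub_self, traceNorm_zero, mul_zero]

theorem traceDist_comm (u v : UGroup n) : traceDist n u v = traceDist n v u := by
  rw [traceDist_eq, traceDist_eq, ← traceNorm_neg, neg_sub]

theorem traceDist_triangle (u v w : UGroup n) :
    traceDist n u w ≤ traceDist n u v + traceDist n v w := by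
  simp only [traceDist_eq]
  rw [← mul_add, ← sub_add_sub_cancel (u : Matrix (Fin n) (Fin n) ℂ) v w]
  exact mul_le_mul_of_nonneg_left (traceNorm_add_le _ _) (by positivity)

/-- By the triangle inequality it suffices that the distances to a fixed pair tend to zero, and the
continuous Hilbert–Schmidt distance controls these. -/
theorem continuous_traceDist :
    Continuous fun p : UGroup n × UGroup n => traceDist n p.1 p.2 := by
  rw [continuous_iff_continuousAt]
  rintro ⟨x, y⟩
  rw [ContinuousAt, tendsto_iff_dist_tendsto_zero]
  have h0 : Tendsto (fun p : UGroup n × UGroup n =>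
      1 / n * (√n * hilbertSchmidtDist n p.1 x) + 1 / n * (√n * hilbertSchmidtDist n p.2 y))
      (𝓝 (x, y)) (𝓝 0) := by
    have h1 := (continuous_hilbertSchmidtDist (n := n)).comp
      ((continuous_fst (X := UGroup n) (Y := UGroup n)).prodMk (continuous_const (y := x)))
    have h2 := (continuous_hilbertSchmidtDist (n := n)).comp
      ((continuous_snd (X := UGroup n) (Y := UGroup n)).prodMk (continuous_const (y := y)))
    have h3 := ((h1.const_mul √n).const_mul (1 / n)).add ((h2.const_mul √n).const_mul (1 / n))
    have h4 := h3.tendsto (x, y)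
    simp only [Function.comp_def, Pi.add_apply, hilbertSchmidtDist_self, mul_zero, add_zero] at h4
    exact h4
  refine squeeze_zero (fun _ => dist_nonneg) (fun p => ?_) h0
  refine le_trans ?_ (add_le_add (traceDist_le_hilbertSchmidtDist p.1 x)
    (traceDist_le_hilbertSchmidtDist p.2 y))
  rw [Real.dist_eq, abs_sub_le_iff]
  have h1 := traceDist_triangle p.1 x p.2
  have h2 := traceDist_triangle x y p.2
  have h3 := traceDist_triangle x p.1 y
  have h4 := traceDist_triangle p.1 p.2 y
  rw [traceDist_comm y] at h2
  rw [traceDist_comm x p.1] at h3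
  constructor <;> linarith

theorem isBiinvariantDist_traceDist : IsBiinvariantDist (traceDist n) where
  continuous := continuous_traceDist
  self := traceDist_self
  symm := traceDist_comm
  triangle := traceDist_triangle
  mul_left g x y := by
    rw [traceDist_eq, traceDist_eq, UnitaryGroup.mul_val, UnitaryGroup.mul_val, ← Matrix.mul_sub,
      traceNorm_unitary_mul g.conjTranspose_mul_self]
  mul_right g x y := by
    rw [traceDist_eq, traceDist_eq, UnitaryGroup.mul_val, UnitaryGroup.mul_val, ← Matrix.sub_mul,
      traceNorm_mul_unitary g.mul_conjTranspose_self g.conjTranspose_mul_self]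

/-- The unitary matrices fixing the first `k` standard basis vectors. -/
def flagStabilizer (n k : ℕ) : Subgroup (UGroup n) where
  carrier := {u | ∀ j : Fin n, (j : ℕ) < k →
    (u : Matrix (Fin n) (Fin n) ℂ) *ᵥ Pi.single j 1 = Pi.single j 1}
  one_mem' := fun j _ => one_mulVec _
  mul_mem' := fun {u v} hu hv j hj => by
    rw [UnitaryGroup.mul_val, ← mulVec_mulVec, hv j hj, hu j hj]
  inv_mem' := fun {u} hu j hj => by
    conv_lhs => rw [← hu j hj]
    rw [mulVec_mulVec, ← UnitaryGroup.mul_val, inv_mul_cancel]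
    exact one_mulVec _

theorem mem_flagStabilizer {k : ℕ} {u : UGroup n} : u ∈ flagStabilizer n k ↔
    ∀ j : Fin n, (j : ℕ) < k →
      (u : Matrix (Fin n) (Fin n) ℂ) *ᵥ Pi.single j 1 = Pi.single j 1 := Iff.rfl

theorem isClosed_flagStabilizer (k : ℕ) : IsClosed (flagStabilizer n k : Set (UGroup n)) := by
  have : (flagStabilizer n k : Set (UGroup n)) = ⋂ j : Fin n, ⋂ _ : (j : ℕ) < k,
      {u : UGroup n | (u : Matrix (Fin n) (Fin n) ℂ) *ᵥ Pi.single j 1 = Pi.single j 1} := by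
    ext u
    simp [mem_flagStabilizer]
  rw [this]
  refine isClosed_iInter fun j => isClosed_iInter fun _ => isClosed_eq ?_ continuous_const
  exact continuous_subtype_val.matrix_mulVec continuous_const

theorem antitone_flagStabilizer : Antitone (flagStabilizer n) :=
  fun _ _ hkl _ hu j hj => hu j (hj.trans_le hkl)

theorem flagStabilizer_zero : flagStabilizer n 0 = ⊤ :=
  eq_top_iff.mpr fun _ _ j hj => absurd hj (Nat.not_lt_zero j)

theorem flagStabilizer_self : flagStabilizer n n = ⊥ := by
  refine eq_bot_iff.mpr fun u hu => ?_
  rw [Subgroup.mem_bot]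
  ext i j
  have := congrFun (hu j j.2) i
  rw [mulVec_single_one, col_apply] at this
  rw [this, UnitaryGroup.one_val, one_apply, Pi.single_apply]

/-- The reflection taking `e_k` to `h e_k` fixes the earlier basis vectors: `h` is unitary and fixes
them, so they are orthogonal to `h e_k - e_k`. -/
theorem exists_traceDist_one_le {k : ℕ} (hk : k < n) {h : UGroup n} (hh : h ∈ flagStabilizer n k) :
    ∃ w : UGroup n, traceDist n w 1 ≤ 2 / n ∧ w⁻¹ * h ∈ flagStabilizer n (k + 1) := by
  set e : Fin n → ℂ := Pi.single ⟨k, hk⟩ 1 with he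
  have hdot : ∀ v, star ((h : Matrix (Fin n) (Fin n) ℂ) *ᵥ e) ⬝ᵥ
      ((h : Matrix (Fin n) (Fin n) ℂ) *ᵥ v) = star e ⬝ᵥ v := by
    intro v
    rw [star_mulVec, dotProduct_mulVec, vecMul_vecMul, h.conjTranspose_mul_self, vecMul_one]
  have hee : star e ⬝ᵥ e = 1 := by simp [he]
  obtain ⟨w, hw, hwe, hfix, htr⟩ := exists_unitary_mulVec_eq ((hdot e).trans hee) hee
  refine ⟨⟨w, hw⟩, ?_, ?_⟩
  · rw [traceDist_eq, div_eq_inv_mul 2, one_div]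
    exact mul_le_mul_of_nonneg_left htr (by positivity)
  · have hwh : ∀ j : Fin n, (j : ℕ) < k + 1 → w *ᵥ Pi.single j 1 =
        (h : Matrix (Fin n) (Fin n) ℂ) *ᵥ Pi.single j 1 := by
      intro j hj
      rcases Nat.lt_succ_iff_lt_or_eq.mp hj with hlt | heq
      · rw [hh j hlt]
        refine hfix _ ?_
        have := hdot (Pi.single j 1)
        rw [hh j hlt] at this
        rw [star_sub, sub_dotProduct, this, sub_self]
      · have : j = ⟨k, hk⟩ := Fin.ext heq
        rw [this]
        exact hwe
    intro j hj
    rw [UnitaryGroup.mul_val, ← mulVec_mulVec, ← hwh j hj, mulVec_mulVec]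
    change ((((⟨w, hw⟩ : UGroup n)⁻¹ * ⟨w, hw⟩ : UGroup n)) : Matrix (Fin n) (Fin n) ℂ) *ᵥ _ = _
    rw [inv_mul_cancel]
    exact one_mulVec _

theorem concentrationFunction_nonneg {X : Type*} [MeasurableSpace X] (d : X → X → ℝ)
    (μ : Measure X) [IsProbabilityMeasure μ] (ε : ℝ) : 0 ≤ concentrationFunction d μ ε := by
  unfold concentrationFunction
  split_ifs
  · norm_num
  · rw [sub_nonneg]
    refine le_trans (csInf_le ?_ ?_) (measureReal_le_one (μ := μ) (s := nbhd d ε Set.univ))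
    · refine ⟨0, ?_⟩
      rintro _ ⟨A, _, _, rfl⟩
      exact measureReal_nonneg
    · exact ⟨Set.univ, MeasurableSet.univ, by norm_num, rfl⟩

/-- A smaller distance has larger neighbourhoods, so one estimate serves both metrics. The constant
comes from chain length `n` and step `2 / n`: `4 n (2 / n)² = 16 / n`. -/
theorem concentrationFunction_haarU_le (hn : 0 < n) {d : UGroup n → UGroup n → ℝ}
    (hd : ∀ u v, d u v ≤ traceDist n u v) {ε : ℝ} (hε : 0 < ε) :
    concentrationFunction d (haarU n) ε ≤ 2 * Real.exp (-(n * ε ^ 2 / 16)) := by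
  have hn' : (0 : ℝ) < n := by exact_mod_cast hn
  rw [concentrationFunction, if_neg hε.ne', sub_le_comm]
  refine le_csInf ⟨_, Set.univ, MeasurableSet.univ, by norm_num, rfl⟩ ?_
  rintro _ ⟨A, _, hA, rfl⟩
  have h := one_sub_le_measureReal_nbhd isBiinvariantDist_traceDist (haarU n) (flagStabilizer n)
    isClosed_flagStabilizer antitone_flagStabilizer flagStabilizer_zero hn flagStabilizer_self
    (a := 2 / n) (by positivity) (fun k hk g hg => exists_traceDist_one_le hk hg) hε hA
  have hexp : ε ^ 2 / (4 * n * (2 / n) ^ 2) = n * ε ^ 2 / 16 := by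
    field_simp
    norm_num
  rw [hexp] at h
  have hsub : nbhd (traceDist n) ε A ⊆ nbhd d ε A := by
    rintro x ⟨y, hy, hxy⟩
    exact ⟨y, hy, (hd x y).trans_lt hxy⟩
  exact h.trans (measureReal_mono hsub)

end UnitaryGroup

theorem tendsto_concentrationFunction_haarU {d : ∀ n : ℕ+, UGroup n → UGroup n → ℝ}
    (hd : ∀ n u v, d n u v ≤ traceDist n u v) {ε : ℝ} (hε : 0 < ε) :
    Tendsto (fun n : ℕ+ => concentrationFunction (d n) (haarU n) ε) atTop (𝓝 0) := by
  refine squeeze_zero (fun n => concentrationFunction_nonneg _ _ _)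
    (fun n => concentrationFunction_haarU_le n.pos (hd n) hε) ?_
  have h1 : Tendsto (fun n : ℕ => (n : ℝ) * (ε ^ 2 / 16)) atTop atTop :=
    tendsto_natCast_atTop_atTop.atTop_mul_const (by positivity)
  have h2 := (Real.tendsto_exp_neg_atTop_nhds_zero.comp h1).const_mul 2
  rw [mul_zero] at h2
  have h3 := h2.comp tendsto_PNat_val_atTop_atTop
  simpa [Function.comp_def, mul_div_assoc] using h3

theorem mainTheorem1 :
    IsLevyFamily (X := fun n : ℕ+ => UGroup n) (fun n => traceDist n) (fun n => haarU n) ∧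
    (∀ (n : ℕ+) (ε : ℝ), 0 ≤ ε →
      concentrationFunction (traceDist n) (haarU n) ε
        ≤ 2 * Real.exp (-((n : ℝ) * ε ^ 2 / 128))) ∧
    IsLevyFamily (X := fun n : ℕ+ => UGroup n)
      (fun n u v => hilbertSchmidtDist n u v / (n : ℝ)) (fun n => haarU n) := by
  have hn : ∀ n : ℕ+, (0 : ℝ) < (n : ℕ) := fun n => by exact_mod_cast n.pos
  have hHS : ∀ (n : ℕ+) (u v : UGroup n), hilbertSchmidtDist n u v / ((n : ℕ) : ℝ) = 0 → u = v :=
    fun n u v h => eq_of_hilbertSchmidtDist_eq_zero ((div_eq_zero_iff.mp h).resolve_right (hn n).ne')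
  refine ⟨⟨fun n => ?_, fun ε hε => tendsto_concentrationFunction_haarU (fun n u v => le_rfl) hε⟩,
    fun n ε hε => ?_, fun n => ?_, fun ε hε => tendsto_concentrationFunction_haarU
      (fun n u v => hilbertSchmidtDist_div_le_traceDist u v) hε⟩
  -- Definiteness is inherited from the smaller Hilbert–Schmidt distance.
  · refine isMMSpace_of_continuous continuous_traceDist traceDist_self traceDist_comm
      traceDist_triangle (fun u v h => hHS n u v (le_antisymm ?_ ?_)) _
    · exact (hilbertSchmidtDist_div_le_traceDist u v).trans_eq h
    · exact div_nonneg (Real.sqrt_nonneg _) (hn n).le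
  · rcases hε.eq_or_lt with rfl | hpos
    -- At `ε = 0` the claim is `1 / 2 ≤ 2`.
    · norm_num [concentrationFunction]
    · refine (concentrationFunction_haarU_le n.pos (fun _ _ => le_rfl) hpos).trans ?_
      have := hn n
      gcongr
      norm_num
  · refine isMMSpace_of_continuous (continuous_hilbertSchmidtDist.div_const _) (fun u => ?_)
      (fun u v => ?_) (fun u v w => ?_) (hHS n) _
    · rw [hilbertSchmidtDist_self, zero_div]
    · rw [hilbertSchmidtDist_comm]
    · rw [← add_div]
      exact div_le_div_of_nonneg_right (hilbertSchmidtDist_triangle u v w) (hn n).le
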